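/- Let $\mathbb{BC}=\{z_1+jz_2:\ z_1,z_2\in\mathbb C\}$, $j^2=-1$, $ij=ji$, be the commutative algebra of bicomplex numbers, with conjugation $(z_1+jz_2)^*=\overline{z_1}-j\overline{z_2}$ and idempotents $e_\pm=\frac{1\pm ij}{2}$, so that every $Z\in\mathbb{BC}$ is uniquely $Z=\alpha e_++\beta e_-$ with $\alpha,\beta\in\mathbb C$; put $e^{Z}=e^{\alpha}e_++e^{\beta}e_-$ and $\sqrt Z=\sqrt\alpha\,e_++\sqrt\beta\,e_-$ (principal branches). Let $\sigma>0$ and $c_0^\sigma=(\sigma/\pi)^{1/2}$. Let $L^{2,\sigma}_{\mathbb{BC}}(\mathbb R)$ be the space of functions $\psi=\psi^+e_++\psi^-e_-:\mathbb R\to\mathbb{BC}$ with $\psi^\pm\in L^2(\mathbb R;c_0^\sigma e^{-\sigma x^2}dx)$, with the inner product $\langle\varphi,\psi\rangle=c_0^\sigma\int_{\mathbb R}\varphi(x)\psi(x)^*e^{-\sigma x^2}dx$ and the norm given by $\|\psi\|^2=\frac{a+b}{2}$ where $\langle\psi,\psi\rangle=ae_++be_-$. Let $\theta=\alpha_\theta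 e_++\beta_\theta e_-$ with $|\alpha_\theta|=|\beta_\theta|=1$ and $1-\theta^2$ invertible in $\mathbb{BC}$ (that is, $\alpha_\theta\ne\pm1$ and $\beta_\theta\ne\pm1$), and let $$\mathcal F^\sigma_\theta\psi(y)=\frac{c_0^\sigma}{\sqrt{1-\theta^2}}\int_{\mathbb R}\psi(x)\,e^{-\frac{\sigma}{1-\theta^2}(x-\theta y)^2}dx ,$$ where the integral is a Lebesgue integral if it converges absolutely for every $y\in\mathbb R$, and otherwise is understood as the limit in $L^{2,\sigma}_{\mathbb{BC}}(\mathbb R)$, as $R\to\infty$, of the functions of $y$ obtained by integrating over $[-R,R]$. Let $$\psi_n(x)=\Big(\frac{1}{2^n\sigma^n n!}\Big)^{1/2}H_n^\sigma(x),\qquad H^\sigma_n(x)=(-1)^ne^{\sigma x^2}\frac{d^n}{dx^n}e^{-\sigma x^2}.$$ Then: 1. For every $\psi\in L^{2,\sigma}_{\mathbb{BC}}(\mathbb R)$, the transform $\mathcal F^\sigma_\theta\psi$ is a well-defined element of $L^{2,\sigma}_{\mathbb{BC}}(\mathbb R)$ (the integrals over $[-R,R]$ converge absolutely, define elements of $L^{2,\sigma}_{\mathbb{BC}}(\mathbb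 R)$, and tend to $\mathcal F^\sigma_\theta\psi$ in this space as $R\to\infty$), and $\|\mathcal F^\sigma_\theta\psi\|=\|\psi\|$. 2. For every $n\ge0$, $\psi_n\in L^{2,\sigma}_{\mathbb{BC}}(\mathbb R)$, the integral defining $\mathcal F^\sigma_\theta\psi_n(y)$ converges absolutely for every $y\in\mathbb R$, and $\mathcal F^\sigma_\theta\psi_n(y)=\theta^n\psi_n(y)$ for every $y\in\mathbb R$. -/

import Mathlib

open MeasureTheory Filter Topology

/-- Bicomplex numbers `z₁ + j z₂` with `z₁, z₂ ∈ ℂ` and `j² = -1`; `Z.re = z₁`, `Z.im = z₂`. -/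
abbrev BC : Type := QuadraticAlgebra ℂ (-1) 0

namespace BC

noncomputable section

/-- The unit `j`. -/
def j : BC := ⟨0, 1⟩

/-- The idempotent `e₊ = (1 + i j) / 2`. -/
def ePlus : BC := algebraMap ℂ BC (1 / 2) * (1 + algebraMap ℂ BC Complex.I * j)

/-- The idempotent `e₋ = (1 - i j) / 2`. -/
def eMinus : BC := algebraMap ℂ BC (1 / 2) * (1 - algebraMap ℂ BC Complex.I * j)

/-- The coefficient `α = z₁ - i z₂` in `Z = α e₊ + β e₋`. -/
def plus (Z : BC) : ℂ := Z.re - Complex.I * Z.im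

/-- The coefficient `β = z₁ + i z₂` in `Z = α e₊ + β e₋`. -/
def minus (Z : BC) : ℂ := Z.re + Complex.I * Z.im

/-- The bicomplex number `α e₊ + β e₋`. -/
def ofIdem (α β : ℂ) : BC := algebraMap ℂ BC α * ePlus + algebraMap ℂ BC β * eMinus

/-- The conjugate `Z* = conj z₁ - j conj z₂`. -/
def conj (Z : BC) : BC := ⟨starRingEnd ℂ Z.re, -starRingEnd ℂ Z.im⟩

/-- `exp (α e₊ + β e₋) = exp α e₊ + exp β e₋`. -/
def exp (Z : BC) : BC := ofIdem (Complex.exp Z.plus) (Complex.exp Z.minus)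

/-- The principal square root `√α e₊ + √β e₋`. -/
def sqrt (Z : BC) : BC := ofIdem (Complex.sqrt Z.plus) (Complex.sqrt Z.minus)

/-- Lebesgue integrability of a `BC`-valued function on a set of reals. -/
def IntegrableOn (f : ℝ → BC) (s : Set ℝ) : Prop :=
  MeasureTheory.IntegrableOn (fun x => (f x).re) s ∧
    MeasureTheory.IntegrableOn (fun x => (f x).im) s

/-- The Lebesgue integral of a `BC`-valued function over a set of reals. -/
def integral (s : Set ℝ) (f : ℝ → BC) : BC :=
  ⟨∫ x in s, (f x).re, ∫ x in s, (f x).im⟩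

/-- The constant `c₀^σ = (σ / π)^(1/2)`, for which `c₀^σ e^{-σ x²} dx` is a probability measure. -/
def c₀ (σ : ℝ) : ℝ := Real.sqrt (σ / Real.pi)

/-- The Gaussian measure `c₀^σ e^{-σ x²} dx` on the real line. -/
def gaussMeasure (σ : ℝ) : Measure ℝ :=
  volume.withDensity fun x => ENNReal.ofReal (c₀ σ * Real.exp (-σ * x ^ 2))

/-- Membership in `L^{2,σ}_BC(ℝ)`: both idempotent components belong to `L^{2,σ}(ℝ)`. -/
def MemL2 (σ : ℝ) (ψ : ℝ → BC) : Prop :=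
  MemLp (fun x => (ψ x).plus) 2 (gaussMeasure σ) ∧
    MemLp (fun x => (ψ x).minus) 2 (gaussMeasure σ)

/-- The `BC`-inner product `c₀^σ ∫ φ(x) ψ(x)* e^{-σ x²} dx`. -/
def inner (σ : ℝ) (φ ψ : ℝ → BC) : BC :=
  algebraMap ℝ BC (c₀ σ) *
    integral Set.univ fun x => φ x * conj (ψ x) * algebraMap ℝ BC (Real.exp (-σ * x ^ 2))

/-- The induced norm: `‖φ‖² = (a + b) / 2` where `⟨φ, φ⟩ = a e₊ + b e₋`
(`a` and `b` are nonnegative real numbers). -/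
def norm (σ : ℝ) (φ : ℝ → BC) : ℝ :=
  Real.sqrt (((inner σ φ φ).plus.re + (inner σ φ φ).minus.re) / 2)

/-- The rescaled Hermite polynomial `H_n^σ(x) = (-1)^n e^{σ x²} (d/dx)^n e^{-σ x²}`. -/
def hermite (σ : ℝ) (n : ℕ) (x : ℝ) : ℝ :=
  (-1) ^ n * Real.exp (σ * x ^ 2) * iteratedDeriv n (fun t : ℝ => Real.exp (-σ * t ^ 2)) x

/-- The normalized Hermite function `ψ_n^σ = (2^n σ^n n!)^{-1/2} H_n^σ`, as a `BC`-valued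
function. -/
def hermiteFun (σ : ℝ) (n : ℕ) (x : ℝ) : BC :=
  algebraMap ℝ BC (Real.sqrt (1 / (2 ^ n * σ ^ n * (n.factorial : ℝ))) * hermite σ n x)

/-- The integrand `ψ(x) exp(-σ / (1 - θ²) (x - θ y)²)`; `Ring.inverse` is the
inverse of an invertible element. -/
def frftIntegrand (σ : ℝ) (θ : BC) (ψ : ℝ → BC) (y x : ℝ) : BC :=
  ψ x * exp (-(algebraMap ℝ BC σ * Ring.inverse (1 - θ ^ 2) *
    (algebraMap ℝ BC x - θ * algebraMap ℝ BC y) ^ 2))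

/-- `c₀^σ / √(1 - θ²) ∫_s ψ(x) exp(-σ / (1 - θ²) (x - θ y)²) dx`. -/
def frftOn (σ : ℝ) (θ : BC) (s : Set ℝ) (ψ : ℝ → BC) (y : ℝ) : BC :=
  algebraMap ℝ BC (c₀ σ) * Ring.inverse (sqrt (1 - θ ^ 2)) *
    integral s (frftIntegrand σ θ ψ y)

/-- `g` is the limit in `L^{2,σ}_BC(ℝ)`, as `R → ∞`, of the transforms
`c₀^σ / √(1 - θ²) ∫_{-R}^{R} ψ(x) exp(-σ / (1 - θ²) (x - θ y)²) dx`, where all integrands are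
absolutely integrable on `[-R, R]`. -/
def IsFrftLimit (σ : ℝ) (θ : BC) (ψ g : ℝ → BC) : Prop :=
  MemL2 σ g ∧
  (∀ R y : ℝ, IntegrableOn (frftIntegrand σ θ ψ y) (Set.Icc (-R) R)) ∧
  (∀ R : ℝ, MemL2 σ (frftOn σ θ (Set.Icc (-R) R) ψ)) ∧
  Tendsto (fun R : ℝ => norm σ (fun y => frftOn σ θ (Set.Icc (-R) R) ψ y - g y)) atTop (𝓝 0)

open Classical in
/-- The bicomplex fractional Fourier transform. It is given by the integral over `ℝ` if that
integral converges absolutely for all `y`. A general `ψ ∈ L^{2,σ}_BC(ℝ)` does not have this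
property (the kernel is of modulus comparable to `e^{-σ x²/2}`), and then, as for the Fourier
transform on `L²`, the integral is the limit in the mean of the integrals over `[-R, R]`, which is
a function determined up to a null set. -/
def frft (σ : ℝ) (θ : BC) (ψ : ℝ → BC) : ℝ → BC :=
  if ∀ y : ℝ, IntegrableOn (frftIntegrand σ θ ψ y) Set.univ then frftOn σ θ Set.univ ψ
  else if h : ∃ g : ℝ → BC, IsFrftLimit σ θ ψ g then h.choose
  else 0

end

end BC

/-! ### Idempotent coordinates -/

namespace BC

/-! In the coordinates `plus` and `minus` the bicomplex algebra is ℂ × ℂ, so everything reduces to a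
scalar transform with parameter α, |α| = 1, α ≠ ±1.

Plancherel: since 1 - α² = α(ᾱ - α) = -2i (Im α) α, the number 1/(1 - α²) has real part 1/2 and α/(1
- α²) is purely imaginary. Expanding (x - αy)² therefore splits the kernel into a factor in x of
modulus e^{-σx²/2}, a Fourier character in x at a frequency proportional to y, and a factor in y of
modulus e^{σy²/2} (`c₀_mul_kernel`). The transform is thus multiplication by a square root of the
Gaussian density, an isometry onto L²(dx), then the Fourier transform, then a dilation and
multiplication, an isometry back (`eLpNorm_gaussMeasure`, `eLpNorm_outMap`). Truncating to a set s
costs exactly the norm of ψ off s (`exists_scalarFrft_limit`), which gives convergence in the mean.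
It also shows that an absolutely convergent integral agrees a.e. with the limit in the mean.

Hermite functions: no Fourier theory is needed. Integration by parts against the kernel gives the
integrals of the Hermite polynomials the recursion satisfied by α^n H_n(y), and the case n = 0 is a
Gaussian integral (`scalarFrftOn_hermitePoly`). -/

theorem ext_idem {Z W : BC} (hp : Z.plus = W.plus) (hm : Z.minus = W.minus) : Z = W := by
  unfold plus at hp
  unfold minus at hm
  have h1 : Z.re = W.re := by linear_combination (hp + hm) / 2
  have h2 : Complex.I * Z.im = Complex.I * W.im := by linear_combination (hm - hp) / 2
  exact QuadraticAlgebra.ext h1 (mul_left_cancel₀ Complex.I_ne_zero h2)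

/-- The ring homomorphism `α e₊ + β e₋ ↦ α`. -/
noncomputable def plusHom : BC →+* ℂ where
  toFun := plus
  map_one' := by simp [plus, QuadraticAlgebra.re_one, QuadraticAlgebra.im_one]
  map_zero' := by simp [plus]
  map_add' x y := by simp [plus]; ring
  map_mul' x y := by
    simp only [plus, QuadraticAlgebra.re_mul, QuadraticAlgebra.im_mul]
    linear_combination -(x.im * y.im) * Complex.I_sq

/-- The ring homomorphism `α e₊ + β e₋ ↦ β`. -/
noncomputable def minusHom : BC →+* ℂ where
  toFun := minus
  map_one' := by simp [minus, QuadraticAlgebra.re_one, QuadraticAlgebra.im_one]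
  map_zero' := by simp [minus]
  map_add' x y := by simp [minus]; ring
  map_mul' x y := by
    simp only [minus, QuadraticAlgebra.re_mul, QuadraticAlgebra.im_mul]
    linear_combination -(x.im * y.im) * Complex.I_sq

@[simp] theorem plus_one : (1 : BC).plus = 1 := map_one plusHom
@[simp] theorem minus_one : (1 : BC).minus = 1 := map_one minusHom
@[simp] theorem plus_sub (Z W : BC) : (Z - W).plus = Z.plus - W.plus := map_sub plusHom Z W
@[simp] theorem minus_sub (Z W : BC) : (Z - W).minus = Z.minus - W.minus := map_sub minusHom Z W
@[simp] theorem plus_neg (Z : BC) : (-Z).plus = -Z.plus := map_neg plusHom Z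
@[simp] theorem minus_neg (Z : BC) : (-Z).minus = -Z.minus := map_neg minusHom Z
@[simp] theorem plus_mul (Z W : BC) : (Z * W).plus = Z.plus * W.plus := map_mul plusHom Z W
@[simp] theorem minus_mul (Z W : BC) : (Z * W).minus = Z.minus * W.minus := map_mul minusHom Z W
@[simp] theorem plus_pow (Z : BC) (n : ℕ) : (Z ^ n).plus = Z.plus ^ n := map_pow plusHom Z n
@[simp] theorem minus_pow (Z : BC) (n : ℕ) : (Z ^ n).minus = Z.minus ^ n := map_pow minusHom Z n

@[simp] theorem plus_algebraMap (r : ℝ) : (algebraMap ℝ BC r).plus = r := by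
  simp [plus, IsScalarTower.algebraMap_apply ℝ ℂ BC]

@[simp] theorem minus_algebraMap (r : ℝ) : (algebraMap ℝ BC r).minus = r := by
  simp [minus, IsScalarTower.algebraMap_apply ℝ ℂ BC]

@[simp] theorem plus_ofIdem (α β : ℂ) : (ofIdem α β).plus = α := by
  simp only [plus, ofIdem, ePlus, eMinus, j, QuadraticAlgebra.algebraMap_eq]
  simp [QuadraticAlgebra.re_one, QuadraticAlgebra.im_one]
  ring_nf
  simp only [Complex.I_sq]
  ring

@[simp] theorem minus_ofIdem (α β : ℂ) : (ofIdem α β).minus = β := by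
  simp only [minus, ofIdem, ePlus, eMinus, j, QuadraticAlgebra.algebraMap_eq]
  simp [QuadraticAlgebra.re_one, QuadraticAlgebra.im_one]
  ring_nf
  simp only [Complex.I_sq]
  ring

@[simp] theorem plus_exp (Z : BC) : (exp Z).plus = Complex.exp Z.plus := plus_ofIdem _ _
@[simp] theorem minus_exp (Z : BC) : (exp Z).minus = Complex.exp Z.minus := minus_ofIdem _ _
@[simp] theorem plus_sqrt (Z : BC) : (sqrt Z).plus = Complex.sqrt Z.plus := plus_ofIdem _ _
@[simp] theorem minus_sqrt (Z : BC) : (sqrt Z).minus = Complex.sqrt Z.minus := minus_ofIdem _ _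

@[simp] theorem plus_conj (Z : BC) : (conj Z).plus = starRingEnd ℂ Z.plus := by
  simp [plus, conj]

@[simp] theorem minus_conj (Z : BC) : (conj Z).minus = starRingEnd ℂ Z.minus := by
  simp [minus, conj]

theorem isUnit_iff {Z : BC} : IsUnit Z ↔ Z.plus ≠ 0 ∧ Z.minus ≠ 0 := by
  refine ⟨fun h => ⟨(h.map plusHom).ne_zero, (h.map minusHom).ne_zero⟩, fun ⟨hp, hm⟩ => ?_⟩
  refine IsUnit.of_mul_eq_one (ofIdem Z.plus⁻¹ Z.minus⁻¹) (ext_idem ?_ ?_) <;> simp [hp, hm]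

theorem plus_inverse {Z : BC} (h : IsUnit Z) : (Ring.inverse Z).plus = Z.plus⁻¹ := by
  refine eq_inv_of_mul_eq_one_left ?_
  rw [← plus_mul, Ring.inverse_mul_cancel _ h, plus_one]

theorem minus_inverse {Z : BC} (h : IsUnit Z) : (Ring.inverse Z).minus = Z.minus⁻¹ := by
  refine eq_inv_of_mul_eq_one_left ?_
  rw [← minus_mul, Ring.inverse_mul_cancel _ h, minus_one]

theorem re_eq (Z : BC) : Z.re = (1 / 2) * (Z.plus + Z.minus) := by
  simp only [plus, minus]; ring

theorem im_eq (Z : BC) : Z.im = (Complex.I / 2) * (Z.plus - Z.minus) := by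
  simp only [plus, minus]
  linear_combination Z.im * Complex.I_sq

/-- The pairs (`re`, `im`) and (`plus`, `minus`) are invertible constant linear combinations of each
other. -/
theorem integrableOn_iff {f : ℝ → BC} {s : Set ℝ} :
    IntegrableOn f s ↔ MeasureTheory.IntegrableOn (fun x => (f x).plus) s ∧
      MeasureTheory.IntegrableOn (fun x => (f x).minus) s := by
  constructor
  · rintro ⟨h1, h2⟩
    exact ⟨Integrable.sub h1 (Integrable.const_mul h2 _),
      Integrable.add h1 (Integrable.const_mul h2 _)⟩
  · rintro ⟨h1, h2⟩
    refine ⟨?_, ?_⟩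
    · simp only [re_eq]
      exact Integrable.const_mul (Integrable.add h1 h2) _
    · simp only [im_eq]
      exact Integrable.const_mul (Integrable.sub h1 h2) _

theorem plus_integral {f : ℝ → BC} {s : Set ℝ} (h : IntegrableOn f s) :
    (integral s f).plus = ∫ x in s, (f x).plus := by
  simp only [plus, integral]
  rw [integral_sub h.1 (Integrable.const_mul h.2 _), integral_const_mul]

theorem minus_integral {f : ℝ → BC} {s : Set ℝ} (h : IntegrableOn f s) :
    (integral s f).minus = ∫ x in s, (f x).minus := by
  simp only [minus, integral]
  rw [integral_add h.1 (Integrable.const_mul h.2 _), integral_const_mul]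

end BC

/-! ### The L² Fourier transform as an integral -/

open scoped FourierTransform SchwartzMap in
/-- On `L¹ ∩ L²` the `L²` Fourier transform is given by the Fourier integral. -/
theorem fourier_toLp_ae_eq {h : ℝ → ℂ} (h1 : Integrable h) (h2 : MemLp h 2) :
    (𝓕 (h2.toLp h) : Lp ℂ 2 (volume : Measure ℝ)) =ᵐ[volume] 𝓕 h := by
  have hcont : Continuous (𝓕 h) :=
    VectorFourier.fourierIntegral_continuous Real.continuous_fourierChar continuous_inner h1
  refine ae_eq_of_integral_contDiff_smul_eq
    ((Lp.memLp _).locallyIntegrable (by norm_num)) hcont.locallyIntegrable fun g hg hgs => ?_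
  have hgc : ContDiff ℝ ((⊤ : ℕ∞) : WithTop ℕ∞) (fun x => (g x : ℂ)) :=
    Complex.ofRealCLM.contDiff.comp hg
  have hgcs : HasCompactSupport (fun x => (g x : ℂ)) := hgs.comp_left Complex.ofReal_zero
  -- Both sides are tested against a smooth compactly supported function, seen as a Schwartz
  -- function. The distributional definition puts 𝓕 on φ, and Fubini moves it to `h`.
  let φ : 𝓢(ℝ, ℂ) := hgcs.toSchwartzMap hgc
  have hφ : ∀ x, φ x = g x := fun x => rfl
  have e := congrArg (fun T : 𝓢'(ℝ, ℂ) => T φ)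
    (Lp.fourier_toTemperedDistribution_eq (h2.toLp h))
  simp only [TemperedDistribution.fourier_apply, Lp.toTemperedDistribution_apply] at e
  have e2 : ∫ x, (𝓕 φ) x • (h2.toLp h) x = ∫ x, (𝓕 φ) x • h x :=
    integral_congr_ae (by filter_upwards [h2.coeFn_toLp] with x hx; rw [hx])
  have e3 : ∫ x, (𝓕 (φ : ℝ → ℂ)) x • h x = ∫ x, φ x • (𝓕 h) x := by
    simpa using! VectorFourier.integral_fourierIntegral_smul_eq_flip (L := innerₗ ℝ)
      Real.continuous_fourierChar continuous_inner φ.integrable h1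
  rw [e2, SchwartzMap.fourier_coe, e3] at e
  simp only [hφ] at e
  simpa only [Complex.real_smul, smul_eq_mul] using e.symm

/-! ### The Gaussian measure and its square roots -/

namespace BC

theorem c₀_pos {σ : ℝ} (hσ : 0 < σ) : 0 < c₀ σ := Real.sqrt_pos.2 (div_pos hσ Real.pi_pos)

theorem c₀_nonneg (σ : ℝ) : 0 ≤ c₀ σ := Real.sqrt_nonneg _

theorem volume_absolutelyContinuous_gaussMeasure {σ : ℝ} (hσ : 0 < σ) :
    (volume : Measure ℝ) ≪ gaussMeasure σ := by
  refine withDensity_absolutelyContinuous' (by fun_prop) (ae_of_all _ fun x => ?_)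
  have := c₀_pos hσ
  simp only [ne_eq, ENNReal.ofReal_eq_zero, not_le]
  positivity

theorem gaussMeasure_absolutelyContinuous (σ : ℝ) : gaussMeasure σ ≪ (volume : Measure ℝ) :=
  withDensity_absolutelyContinuous _ _

theorem eLpNorm_two_eq_lintegral {μ : Measure ℝ} (f : ℝ → ℂ) :
    eLpNorm f 2 μ = (∫⁻ x, ‖f x‖ₑ ^ 2 ∂μ) ^ (1 / 2 : ℝ) := by
  rw [eLpNorm_eq_lintegral_rpow_enorm_toReal (by norm_num) (by norm_num)]
  simp

theorem lintegral_gaussMeasure (σ : ℝ) (f : ℝ → ENNReal) :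
    ∫⁻ x, f x ∂(gaussMeasure σ) =
      ∫⁻ x, ENNReal.ofReal (c₀ σ * Real.exp (-σ * x ^ 2)) * f x := by
  rw [gaussMeasure, lintegral_withDensity_eq_lintegral_mul_non_measurable _ (by fun_prop)
    (ae_of_all _ fun x => ENNReal.ofReal_lt_top)]
  rfl

/-- Multiplication by a square root of the Gaussian density maps `L²(gaussMeasure σ)`
isometrically to `L²(ℝ)`. -/
theorem eLpNorm_gaussMeasure {σ : ℝ} {D : ℝ → ℂ}
    (hD : ∀ x, ‖D x‖ ^ 2 = c₀ σ * Real.exp (-σ * x ^ 2)) (f : ℝ → ℂ) :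
    eLpNorm f 2 (gaussMeasure σ) = eLpNorm (fun x => D x * f x) 2 volume := by
  rw [eLpNorm_two_eq_lintegral, eLpNorm_two_eq_lintegral, lintegral_gaussMeasure]
  congr 2
  ext x
  rw [← hD, enorm_mul, mul_pow, ENNReal.ofReal_pow (norm_nonneg _), ofReal_norm]

/-- The norms agree by `eLpNorm_gaussMeasure`. Measurability passes both ways because D is
continuous and vanishes nowhere. -/
theorem memLp_gaussMeasure_iff {σ : ℝ} (hσ : 0 < σ) {D : ℝ → ℂ} (hDc : Continuous D)
    (hD : ∀ x, ‖D x‖ ^ 2 = c₀ σ * Real.exp (-σ * x ^ 2)) (f : ℝ → ℂ) :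
    MemLp f 2 (gaussMeasure σ) ↔ MemLp (fun x => D x * f x) 2 volume := by
  have hD0 : ∀ x, D x ≠ 0 := fun x h0 => by
    have h1 := hD x
    have := c₀_pos hσ
    rw [h0, norm_zero, zero_pow two_ne_zero] at h1
    exact absurd h1.symm (by positivity)
  unfold MemLp
  rw [← eLpNorm_gaussMeasure hD]
  refine and_congr_left fun _ => ⟨fun h => ?_, fun h => ?_⟩
  · exact hDc.aestronglyMeasurable.mul
      (h.mono_ac (volume_absolutelyContinuous_gaussMeasure hσ))
  · refine AEStronglyMeasurable.mono_ac (gaussMeasure_absolutelyContinuous σ) ?_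
    refine (((hDc.inv₀ hD0).aestronglyMeasurable (μ := volume)).mul h).congr
      (ae_of_all _ fun x => ?_)
    simp [inv_mul_cancel_left₀ (hD0 x)]

theorem lintegral_comp_mul_left {a : ℝ} (ha : a ≠ 0) (f : ℝ → ENNReal) :
    ENNReal.ofReal |a| * ∫⁻ x, f (a * x) = ∫⁻ x, f x := by
  conv_rhs => rw [← Real.smul_map_volume_mul_left ha]
  rw [lintegral_smul_measure, (measurableEmbedding_mulLeft₀ ha).lintegral_map]
  rfl

/-- The kernel `exp(-σ / (1 - α²) (x - α y)²)`. -/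
noncomputable def kernel (σ : ℝ) (α : ℂ) (y x : ℝ) : ℂ :=
  Complex.exp (-(σ * (1 - α ^ 2)⁻¹ * (x - α * y) ^ 2))

/-- The complex fractional Fourier transform of the restriction of a function to `s`. -/
noncomputable def scalarFrftOn (σ : ℝ) (α : ℂ) (s : Set ℝ) (f : ℝ → ℂ) (y : ℝ) : ℂ :=
  c₀ σ * (Complex.sqrt (1 - α ^ 2))⁻¹ * ∫ x in s, f x * kernel σ α y x

/-! ### Factorization of the kernel for a unimodular parameter -/

section Unimodular

variable {α : ℂ}

theorem im_ne_zero_of_unimodular (h1 : ‖α‖ = 1) (h2 : 1 - α ^ 2 ≠ 0) : α.im ≠ 0 := by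
  intro h
  have h3 : α.re ^ 2 = 1 := by
    have := Complex.sq_norm α
    rw [h1, Complex.normSq_apply, h] at this
    linarith
  apply h2
  have : α = α.re := Complex.ext (by simp) (by simp [h])
  rw [this, ← Complex.ofReal_pow, h3]
  simp

/-- Write 1 = αᾱ and factor out α. -/
theorem one_sub_sq_of_unimodular (h1 : ‖α‖ = 1) :
    1 - α ^ 2 = -2 * Complex.I * α.im * α := by
  have h3 : α.re ^ 2 + α.im ^ 2 = 1 := by
    have := Complex.sq_norm α
    rw [h1, Complex.normSq_apply] at this
    linarith
  apply Complex.ext <;> simp [pow_two]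
  · linarith
  · ring

/-- `1 / (1 - α²) = 1/2 + i cot(arg α) / 2`. -/
theorem inv_one_sub_sq_of_unimodular (h1 : ‖α‖ = 1) (h2 : 1 - α ^ 2 ≠ 0) :
    (1 - α ^ 2)⁻¹ = 1 / 2 + ((α.re / (2 * α.im) : ℝ) : ℂ) * Complex.I := by
  have h3 : α.re ^ 2 + α.im ^ 2 = 1 := by
    have := Complex.sq_norm α
    rw [h1, Complex.normSq_apply] at this
    linarith
  have hs := im_ne_zero_of_unimodular h1 h2
  rw [inv_eq_iff_eq_inv]
  refine eq_inv_of_mul_eq_one_left ?_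
  rw [one_sub_sq_of_unimodular h1]
  obtain ⟨t, ht⟩ : ∃ t, t = α.re / (2 * α.im) := ⟨_, rfl⟩
  have ht' : α.re = t * (2 * α.im) := by rw [ht]; field_simp
  rw [← ht]
  apply Complex.ext <;> simp
  · linear_combination h3 - α.re * ht'
  · linear_combination (-α.im) * ht'

/-- This number is purely imaginary, which turns the cross term of the kernel's exponent into a
Fourier character. -/
theorem mul_inv_one_sub_sq_of_unimodular (h1 : ‖α‖ = 1) (h2 : 1 - α ^ 2 ≠ 0) :
    α * (1 - α ^ 2)⁻¹ = Complex.I / (2 * α.im) := by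
  have hs : (α.im : ℂ) ≠ 0 := by exact_mod_cast im_ne_zero_of_unimodular h1 h2
  have ha : α ≠ 0 := by rintro rfl; simp at h1
  rw [one_sub_sq_of_unimodular h1]
  field_simp
  linear_combination (-1 : ℂ) * Complex.I_sq

theorem norm_sqrt_one_sub_sq (h1 : ‖α‖ = 1) :
    ‖Complex.sqrt (1 - α ^ 2)‖ ^ 2 = 2 * |α.im| := by
  rw [← norm_pow, Complex.sqrt, ← Complex.cpow_nat_mul]
  simp [one_sub_sq_of_unimodular h1, h1]

/-- The weight `√c₀ exp(-σ x² / (1 - α²))`, a square root of the Gaussian density. -/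
noncomputable def inWeight (σ : ℝ) (α : ℂ) (x : ℝ) : ℂ :=
  (Real.sqrt (c₀ σ) : ℂ) * Complex.exp (-(σ * (1 - α ^ 2)⁻¹ * x ^ 2))

/-- The factor `√c₀ / √(1 - α²) exp(-σ α² y² / (1 - α²))`. -/
noncomputable def outWeight (σ : ℝ) (α : ℂ) (y : ℝ) : ℂ :=
  (Real.sqrt (c₀ σ) : ℂ) * (Complex.sqrt (1 - α ^ 2))⁻¹ *
    Complex.exp (-(σ * ((1 - α ^ 2)⁻¹ - 1) * y ^ 2))

/-- The scaling factor of the frequency variable. -/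
noncomputable def freqScale (σ : ℝ) (α : ℂ) : ℝ := -(σ / (2 * Real.pi * α.im))

/-- The map from the Fourier side to `L²(gaussMeasure σ)`. -/
noncomputable def outMap (σ : ℝ) (α : ℂ) (h : ℝ → ℂ) (y : ℝ) : ℂ :=
  outWeight σ α y * h (freqScale σ α * y)

theorem continuous_inWeight (σ : ℝ) (α : ℂ) : Continuous (inWeight σ α) := by
  unfold inWeight; fun_prop

theorem continuous_outWeight (σ : ℝ) (α : ℂ) : Continuous (outWeight σ α) := by
  unfold outWeight; fun_prop

theorem norm_sq_inWeight {σ : ℝ} (h1 : ‖α‖ = 1) (h2 : 1 - α ^ 2 ≠ 0) (x : ℝ) :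
    ‖inWeight σ α x‖ ^ 2 = c₀ σ * Real.exp (-σ * x ^ 2) := by
  rw [inWeight, norm_mul, mul_pow, Complex.norm_real, Real.norm_eq_abs, sq_abs,
    Real.sq_sqrt (c₀_nonneg σ), Complex.norm_exp, ← Real.exp_nat_mul,
    inv_one_sub_sq_of_unimodular h1 h2]
  generalize α.re / (2 * α.im) = t
  congr 2
  simp [pow_two]
  ring

/-- The growth e^{σy²} of |`outWeight`|² cancels the density. The remaining constant c₀²/(2|Im α|) =
σ/(2π|Im α|) is the Jacobian of the dilation in `outMap`. -/
theorem norm_sq_outWeight {σ : ℝ} (hσ : 0 < σ) (h1 : ‖α‖ = 1) (h2 : 1 - α ^ 2 ≠ 0) (y : ℝ) :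
    (c₀ σ * Real.exp (-σ * y ^ 2)) * ‖outWeight σ α y‖ ^ 2 = |freqScale σ α| := by
  have hs := im_ne_zero_of_unimodular h1 h2
  have e : Real.exp (-σ * y ^ 2) *
      ‖Complex.exp (-(σ * ((1 - α ^ 2)⁻¹ - 1) * y ^ 2))‖ ^ 2 = 1 := by
    rw [Complex.norm_exp, ← Real.exp_nat_mul, ← Real.exp_add, inv_one_sub_sq_of_unimodular h1 h2]
    generalize α.re / (2 * α.im) = t
    convert Real.exp_zero using 2
    simp [pow_two]
    ring
  rw [outWeight, norm_mul, norm_mul, mul_pow, mul_pow, Complex.norm_real, Real.norm_eq_abs, sq_abs,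
    Real.sq_sqrt (c₀_nonneg σ), norm_inv, inv_pow, norm_sqrt_one_sub_sq h1]
  have hc : c₀ σ ^ 2 = σ / Real.pi := Real.sq_sqrt (by positivity)
  have : |freqScale σ α| = σ / Real.pi * (2 * |α.im|)⁻¹ := by
    rw [freqScale, abs_neg, abs_div, abs_mul, abs_of_pos hσ, abs_of_pos (by positivity)]
    field_simp
  rw [this, ← hc]
  linear_combination c₀ σ ^ 2 * (2 * |α.im|)⁻¹ * e

theorem freqScale_ne_zero {σ : ℝ} (hσ : 0 < σ) (h1 : ‖α‖ = 1) (h2 : 1 - α ^ 2 ≠ 0) :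
    freqScale σ α ≠ 0 := by
  have hs := im_ne_zero_of_unimodular h1 h2
  unfold freqScale
  have := Real.pi_ne_zero
  have := hσ.ne'
  simp_all

theorem eLpNorm_outMap {σ : ℝ} (hσ : 0 < σ) (h1 : ‖α‖ = 1) (h2 : 1 - α ^ 2 ≠ 0) (h : ℝ → ℂ) :
    eLpNorm (outMap σ α h) 2 (gaussMeasure σ) = eLpNorm h 2 volume := by
  rw [eLpNorm_two_eq_lintegral, eLpNorm_two_eq_lintegral, lintegral_gaussMeasure,
    ← lintegral_comp_mul_left (freqScale_ne_zero hσ h1 h2) fun x => ‖h x‖ₑ ^ 2, ← lintegral_const_mul' _ _ (by simp)]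
  congr 2
  ext y
  have hc := c₀_pos hσ
  rw [outMap, enorm_mul, mul_pow, ← norm_sq_outWeight hσ h1 h2 y,
    ENNReal.ofReal_mul (q := ‖outWeight σ α y‖ ^ 2) (by positivity),
    ENNReal.ofReal_pow (norm_nonneg _), ofReal_norm, mul_assoc]

theorem aestronglyMeasurable_comp_mul_left {a : ℝ} (ha : a ≠ 0) {h : ℝ → ℂ}
    (hh : AEStronglyMeasurable h volume) : AEStronglyMeasurable (fun y => h (a * y)) volume := by
  refine hh.comp_quasiMeasurePreserving ⟨by fun_prop, ?_⟩
  rw [Real.map_volume_mul_left ha]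
  exact Measure.smul_absolutelyContinuous

theorem memLp_outMap {σ : ℝ} (hσ : 0 < σ) (h1 : ‖α‖ = 1) (h2 : 1 - α ^ 2 ≠ 0) {h : ℝ → ℂ}
    (hh : MemLp h 2 volume) : MemLp (outMap σ α h) 2 (gaussMeasure σ) := by
  refine ⟨AEStronglyMeasurable.mono_ac (gaussMeasure_absolutelyContinuous σ) ?_, ?_⟩
  · exact (continuous_outWeight σ α).aestronglyMeasurable.mul
      (aestronglyMeasurable_comp_mul_left (freqScale_ne_zero hσ h1 h2) hh.1)
  · rw [eLpNorm_outMap hσ h1 h2]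
    exact hh.2

theorem outMap_congr {σ : ℝ} (hσ : 0 < σ) (h1 : ‖α‖ = 1) (h2 : 1 - α ^ 2 ≠ 0) {h h' : ℝ → ℂ}
    (hh : h =ᵐ[volume] h') : outMap σ α h =ᵐ[gaussMeasure σ] outMap σ α h' := by
  refine (gaussMeasure_absolutelyContinuous σ).ae_le ?_
  have hq : Measure.QuasiMeasurePreserving (fun y => freqScale σ α * y) volume volume := by
    refine ⟨by fun_prop, ?_⟩
    rw [Real.map_volume_mul_left (freqScale_ne_zero hσ h1 h2)]
    exact Measure.smul_absolutelyContinuous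
  filter_upwards [hq.ae_eq_comp hh] with y hy
  simp only [Function.comp_apply] at hy
  simp only [outMap, hy]

theorem c₀_mul_kernel {σ : ℝ} (h1 : ‖α‖ = 1) (h2 : 1 - α ^ 2 ≠ 0) (y x : ℝ) :
    c₀ σ * (Complex.sqrt (1 - α ^ 2))⁻¹ * kernel σ α y x = outWeight σ α y *
      (Complex.exp (((-2 * Real.pi * x * (freqScale σ α * y) : ℝ) : ℂ) * Complex.I) *
        inWeight σ α x) := by
  have hs : (α.im : ℂ) ≠ 0 := by exact_mod_cast im_ne_zero_of_unimodular h1 h2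
  have hpi : (Real.pi : ℂ) ≠ 0 := by exact_mod_cast Real.pi_ne_zero
  have hc : (c₀ σ : ℂ) = (Real.sqrt (c₀ σ) : ℂ) * (Real.sqrt (c₀ σ) : ℂ) := by
    rw [← Complex.ofReal_mul, Real.mul_self_sqrt (c₀_nonneg σ)]
  have he : kernel σ α y x = Complex.exp (-(σ * ((1 - α ^ 2)⁻¹ - 1) * y ^ 2)) *
      (Complex.exp (((-2 * Real.pi * x * (freqScale σ α * y) : ℝ) : ℂ) * Complex.I) *
        Complex.exp (-(σ * (1 - α ^ 2)⁻¹ * x ^ 2))) := by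
    rw [kernel, ← Complex.exp_add, ← Complex.exp_add]
    congr 1
    -- `hA` rewrites the coefficient of xy and `hB` that of y².
    have hA := mul_inv_one_sub_sq_of_unimodular h1 h2
    have hB : α ^ 2 * (1 - α ^ 2)⁻¹ = (1 - α ^ 2)⁻¹ - 1 := by field_simp; ring
    have hF : ((-2 * Real.pi * x * (freqScale σ α * y) : ℝ) : ℂ) * Complex.I =
        2 * σ * x * y * (Complex.I / (2 * α.im)) := by
      simp only [freqScale]
      push_cast
      field_simp
    rw [hF, ← hA, ← hB]
    ring
  rw [hc, he, outWeight, inWeight]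
  ring

/-- The integrands agree pointwise, so no integrability is needed: both sides take the same default
value when the integral diverges. -/
theorem scalarFrftOn_eq {σ : ℝ} (h1 : ‖α‖ = 1) (h2 : 1 - α ^ 2 ≠ 0) {s : Set ℝ}
    (hs : MeasurableSet s) (f : ℝ → ℂ) :
    scalarFrftOn σ α s f =
      outMap σ α (FourierTransform.fourier (s.indicator fun x => inWeight σ α x * f x)) := by
  ext y
  rw [scalarFrftOn, outMap, Real.fourier_real_eq_integral_exp_smul, ← integral_indicator hs,
    ← integral_const_mul, ← integral_const_mul]
  congr 1
  ext x
  by_cases hx : x ∈ s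
  · simp only [Set.indicator_of_mem hx, smul_eq_mul]
    linear_combination f x * c₀_mul_kernel h1 h2 y x
  · simp [Set.indicator_of_notMem hx]

/-- As functions of x, the two integrands differ by a nonzero constant and a unimodular factor.
Hence absolute convergence does not depend on y. -/
theorem integrableOn_mul_kernel_iff {σ : ℝ} (hσ : 0 < σ) (h1 : ‖α‖ = 1) (h2 : 1 - α ^ 2 ≠ 0)
    {s : Set ℝ} (f : ℝ → ℂ) (y : ℝ) :
    MeasureTheory.IntegrableOn (fun x => f x * kernel σ α y x) s ↔
      MeasureTheory.IntegrableOn (fun x => inWeight σ α x * f x) s := by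
  have hc : (c₀ σ : ℂ) ≠ 0 := by exact_mod_cast (c₀_pos hσ).ne'
  have hr : (Complex.sqrt (1 - α ^ 2))⁻¹ ≠ 0 := by
    simp [Complex.sqrt, Complex.cpow_eq_zero_iff, h2]
  have hq : (Real.sqrt (c₀ σ) : ℂ) ≠ 0 := by exact_mod_cast (Real.sqrt_pos.2 (c₀_pos hσ)).ne'
  have ho : outWeight σ α y ≠ 0 := by simp only [outWeight]; simp_all
  set u : ℝ → ℂ :=
    fun x => Complex.exp (((-2 * Real.pi * x * (freqScale σ α * y) : ℝ) : ℂ) * Complex.I) with hu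
  have huc : Continuous u := by fun_prop
  have hu1 : ∀ x, ‖u x‖ = 1 := fun x => Complex.norm_exp_ofReal_mul_I _
  have hu0 : ∀ x, u x ≠ 0 := fun x => Complex.exp_ne_zero _
  have hk : ∀ x, c₀ σ * (Complex.sqrt (1 - α ^ 2))⁻¹ * (f x * kernel σ α y x) =
      outWeight σ α y * (u x * (inWeight σ α x * f x)) := fun x => by
    linear_combination f x * c₀_mul_kernel h1 h2 y x
  unfold MeasureTheory.IntegrableOn
  rw [← integrable_const_mul_iff (IsUnit.mk0 _ (mul_ne_zero hc hr))]
  simp only [hk]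
  rw [integrable_const_mul_iff (IsUnit.mk0 _ ho)]
  constructor
  · intro h
    refine (h.bdd_mul (c := 1) (huc.inv₀ hu0).aestronglyMeasurable
      (ae_of_all _ fun x => by simp [hu1])).congr (ae_of_all _ fun x => ?_)
    simp [inv_mul_cancel_left₀ (hu0 x)]
  · intro h
    exact h.bdd_mul (c := 1) huc.aestronglyMeasurable (ae_of_all _ fun x => by simp [hu1])

/-- On a bounded interval L² is contained in L¹. -/
theorem integrableOn_mul_kernel_Icc {σ : ℝ} (hσ : 0 < σ) (h1 : ‖α‖ = 1) (h2 : 1 - α ^ 2 ≠ 0)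
    {f : ℝ → ℂ} (hf : MemLp f 2 (gaussMeasure σ)) (y a b : ℝ) :
    MeasureTheory.IntegrableOn (fun x => f x * kernel σ α y x) (Set.Icc a b) := by
  rw [integrableOn_mul_kernel_iff hσ h1 h2]
  have h := (memLp_gaussMeasure_iff hσ (continuous_inWeight σ α) (norm_sq_inWeight h1 h2) f).1 hf
  exact (h.restrict (Set.Icc a b)).integrable (by norm_num)

open scoped FourierTransform in
theorem norm_fourier_sub_fourier (a b : Lp ℂ 2 (volume : Measure ℝ)) :
    ‖𝓕 a - 𝓕 b‖ = ‖a - b‖ := by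
  have h := (Lp.fourierTransformₗᵢ ℝ ℂ).dist_map a b
  rwa [dist_eq_norm, dist_eq_norm] at h

open scoped FourierTransform in
/-- The limit in the mean of the truncated transforms. -/
theorem exists_scalarFrft_limit {σ : ℝ} (hσ : 0 < σ) (h1 : ‖α‖ = 1) (h2 : 1 - α ^ 2 ≠ 0)
    {f : ℝ → ℂ} (hf : MemLp f 2 (gaussMeasure σ)) :
    ∃ g : ℝ → ℂ, MemLp g 2 (gaussMeasure σ) ∧
      eLpNorm g 2 (gaussMeasure σ) = eLpNorm f 2 (gaussMeasure σ) ∧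
      ∀ s : Set ℝ, MeasurableSet s →
        (∀ y, MeasureTheory.IntegrableOn (fun x => f x * kernel σ α y x) s) →
        MemLp (scalarFrftOn σ α s f) 2 (gaussMeasure σ) ∧
        eLpNorm (fun y => scalarFrftOn σ α s f y - g y) 2 (gaussMeasure σ) =
          eLpNorm (sᶜ.indicator f) 2 (gaussMeasure σ) := by
  have hD := norm_sq_inWeight (σ := σ) h1 h2
  set V : ℝ → ℂ := fun x => inWeight σ α x * f x with hV
  have hVm : MemLp V 2 volume := (memLp_gaussMeasure_iff hσ (continuous_inWeight σ α) hD f).1 hf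
  -- One limit serves every admissible s: later, s = [-R, R] gives convergence in the mean, and s =
  -- ℝ identifies the limit with the full integral.
  let G : Lp ℂ 2 (volume : Measure ℝ) := 𝓕 (hVm.toLp V)
  refine ⟨outMap σ α G, memLp_outMap hσ h1 h2 (Lp.memLp G), ?_, fun s hs hi => ?_⟩
  · have : ‖G‖ = ‖hVm.toLp V‖ := Lp.norm_fourier_eq _
    rw [eLpNorm_outMap hσ h1 h2, eLpNorm_gaussMeasure hD, ← Lp.enorm_def, ← ofReal_norm, this,
      ofReal_norm, Lp.enorm_toLp]
  · have hVs : MemLp (s.indicator V) 2 volume := hVm.indicator hs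
    have hVi : Integrable (s.indicator V) :=
      (integrable_indicator_iff hs).2 ((integrableOn_mul_kernel_iff hσ h1 h2 f 0).1 (hi 0))
    have hae := fourier_toLp_ae_eq hVi hVs
    have hT : scalarFrftOn σ α s f = outMap σ α (𝓕 (s.indicator V)) :=
      scalarFrftOn_eq h1 h2 hs f
    have hTae := outMap_congr hσ h1 h2 hae
    rw [← hT] at hTae
    refine ⟨(memLp_outMap hσ h1 h2 (Lp.memLp _)).ae_eq hTae, ?_⟩
    have hVc : MemLp (sᶜ.indicator V) 2 volume := hVm.indicator hs.compl
    -- The truncation error is the part of `V` off s, up to sign, and every later map preserves its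
    -- norm.
    have hsub : hVs.toLp _ - hVm.toLp V = -hVc.toLp _ := by
      rw [← MemLp.toLp_sub, ← MemLp.toLp_neg, MemLp.toLp_eq_toLp_iff]
      refine ae_of_all _ fun x => ?_
      by_cases hx : x ∈ s <;> simp [hx]
    have e1 : (fun y => scalarFrftOn σ α s f y - outMap σ α G y) =ᵐ[gaussMeasure σ]
        outMap σ α (𝓕 (hVs.toLp _) - G : Lp ℂ 2 (volume : Measure ℝ)) := by
      refine EventuallyEq.trans ?_ (outMap_congr hσ h1 h2 (Lp.coeFn_sub _ _)).symm
      filter_upwards [hTae] with y hy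
      simp only [← hy, outMap, Pi.sub_apply]
      ring
    have e2 : ‖(𝓕 (hVs.toLp _) - G : Lp ℂ 2 (volume : Measure ℝ))‖ = ‖hVc.toLp _‖ := by
      rw [← norm_neg (hVc.toLp _), ← hsub, norm_fourier_sub_fourier]
    rw [eLpNorm_congr_ae e1, eLpNorm_outMap hσ h1 h2, ← Lp.enorm_def, ← ofReal_norm, e2,
      ofReal_norm, Lp.enorm_toLp, eLpNorm_gaussMeasure hD]
    congr 1
    ext x
    by_cases hx : x ∈ s <;> simp [hx, hV]

end Unimodular

/-! ### Limits in the mean and the bicomplex Plancherel theorem -/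

theorem tendsto_eLpNorm_indicator_compl_Icc {μ : Measure ℝ} {f : ℝ → ℂ} (hf : MemLp f 2 μ) :
    Tendsto (fun R : ℝ => eLpNorm ((Set.Icc (-R) R)ᶜ.indicator f) 2 μ) atTop (𝓝 0) := by
  simp only [eLpNorm_two_eq_lintegral]
  have hfin : ∫⁻ x, ‖f x‖ₑ ^ 2 ∂μ ≠ ⊤ := by
    have h := hf.2
    rw [eLpNorm_two_eq_lintegral] at h
    intro h'
    simp [h'] at h
  have key : Tendsto (fun R : ℝ => ∫⁻ x, ‖(Set.Icc (-R) R)ᶜ.indicator f x‖ₑ ^ 2 ∂μ) atTop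
      (𝓝 (∫⁻ _, 0 ∂μ)) := by
    -- Dominated convergence with bound |f|²: at each x the truncated tail is zero once R ≥ |x|.
    refine tendsto_lintegral_filter_of_dominated_convergence' (fun x => ‖f x‖ₑ ^ 2)
      (Eventually.of_forall fun R => ?_) (Eventually.of_forall fun R => ae_of_all _ fun x => ?_)
      hfin (ae_of_all _ fun x => ?_)
    · exact (hf.1.indicator measurableSet_Icc.compl).enorm.pow_const 2
    · gcongr
      exact enorm_indicator_le_enorm_self _ _
    · refine tendsto_const_nhds.congr' ?_
      filter_upwards [eventually_ge_atTop |x|] with R hR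
      rw [Set.indicator_of_notMem]
      · simp
      · simpa using abs_le.1 hR
  rw [lintegral_zero] at key
  simpa [Function.comp_def] using
    ((ENNReal.continuous_rpow_const (y := (1 / 2 : ℝ))).tendsto 0).comp key

theorem plus_frftIntegrand (σ : ℝ) {θ : BC} (hθ : IsUnit (1 - θ ^ 2)) (ψ : ℝ → BC) (y x : ℝ) :
    (frftIntegrand σ θ ψ y x).plus = (ψ x).plus * kernel σ θ.plus y x := by
  simp [frftIntegrand, kernel, plus_inverse hθ]

theorem minus_frftIntegrand (σ : ℝ) {θ : BC} (hθ : IsUnit (1 - θ ^ 2)) (ψ : ℝ → BC) (y x : ℝ) :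
    (frftIntegrand σ θ ψ y x).minus = (ψ x).minus * kernel σ θ.minus y x := by
  simp [frftIntegrand, kernel, minus_inverse hθ]

theorem integrableOn_frftIntegrand_iff {σ : ℝ} {θ : BC} (hθ : IsUnit (1 - θ ^ 2)) {ψ : ℝ → BC}
    {y : ℝ} {s : Set ℝ} : IntegrableOn (frftIntegrand σ θ ψ y) s ↔
      MeasureTheory.IntegrableOn (fun x => (ψ x).plus * kernel σ θ.plus y x) s ∧
      MeasureTheory.IntegrableOn (fun x => (ψ x).minus * kernel σ θ.minus y x) s := by
  simp only [integrableOn_iff, plus_frftIntegrand σ hθ, minus_frftIntegrand σ hθ]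

theorem isUnit_sqrt {Z : BC} (h : IsUnit Z) : IsUnit (sqrt Z) := by
  rw [isUnit_iff] at h ⊢
  simpa [Complex.sqrt, Complex.cpow_eq_zero_iff] using h

theorem plus_frftOn {σ : ℝ} {θ : BC} (hθ : IsUnit (1 - θ ^ 2)) {ψ : ℝ → BC} {s : Set ℝ} {y : ℝ}
    (h : IntegrableOn (frftIntegrand σ θ ψ y) s) :
    (frftOn σ θ s ψ y).plus = scalarFrftOn σ θ.plus s (fun x => (ψ x).plus) y := by
  simp [frftOn, scalarFrftOn, plus_integral h, plus_inverse (isUnit_sqrt hθ),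
    plus_frftIntegrand σ hθ]

theorem minus_frftOn {σ : ℝ} {θ : BC} (hθ : IsUnit (1 - θ ^ 2)) {ψ : ℝ → BC} {s : Set ℝ} {y : ℝ}
    (h : IntegrableOn (frftIntegrand σ θ ψ y) s) :
    (frftOn σ θ s ψ y).minus = scalarFrftOn σ θ.minus s (fun x => (ψ x).minus) y := by
  simp [frftOn, scalarFrftOn, minus_integral h, minus_inverse (isUnit_sqrt hθ),
    minus_frftIntegrand σ hθ]

theorem integrable_weighted_sq_norm {σ : ℝ} (hσ : 0 < σ) {f : ℝ → ℂ}
    (hf : MemLp f 2 (gaussMeasure σ)) :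
    Integrable fun x => ‖f x‖ ^ 2 * Real.exp (-σ * x ^ 2) := by
  have h := hf.integrable_norm_pow (p := 2) (by norm_num)
  rw [gaussMeasure, integrable_withDensity_iff_integrable_smul' (by fun_prop)
    (ae_of_all _ fun x => ENNReal.ofReal_lt_top)] at h
  refine (h.const_mul (c₀ σ)⁻¹).congr (ae_of_all _ fun x => ?_)
  have hc := c₀_pos hσ
  simp only [smul_eq_mul]
  rw [ENNReal.toReal_ofReal (by positivity)]
  field_simp

theorem weighted_integral_sq_norm {σ : ℝ} {f : ℝ → ℂ} (hf : MemLp f 2 (gaussMeasure σ)) :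
    c₀ σ * ∫ x, ‖f x‖ ^ 2 * Real.exp (-σ * x ^ 2) =
      (eLpNorm f 2 (gaussMeasure σ)).toReal ^ 2 := by
  have h1 : (eLpNorm f 2 (gaussMeasure σ)).toReal ^ 2 = ∫ x, ‖f x‖ ^ 2 ∂(gaussMeasure σ) := by
    rw [hf.eLpNorm_eq_integral_rpow_norm (by norm_num) (by norm_num),
      ENNReal.toReal_ofReal (by positivity)]
    simp only [ENNReal.toReal_ofNat, Real.rpow_ofNat]
    rw [← Real.rpow_natCast, ← Real.rpow_mul (integral_nonneg fun x => by positivity)]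
    norm_num
  rw [h1, gaussMeasure, integral_withDensity_eq_integral_toReal_smul (by fun_prop)
    (ae_of_all _ fun x => ENNReal.ofReal_lt_top), ← integral_const_mul]
  congr 1
  ext x
  have hc := c₀_nonneg σ
  rw [ENNReal.toReal_ofReal (by positivity), smul_eq_mul]
  ring

/-- Bicomplex conjugation conjugates each idempotent coordinate, so ⟨φ, φ⟩ has the squared L² norms
of the two components as its coordinates. -/
theorem norm_eq {σ : ℝ} (hσ : 0 < σ) {φ : ℝ → BC} (hφ : MemL2 σ φ) :
    norm σ φ = Real.sqrt (((eLpNorm (fun x => (φ x).plus) 2 (gaussMeasure σ)).toReal ^ 2 +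
      (eLpNorm (fun x => (φ x).minus) 2 (gaussMeasure σ)).toReal ^ 2) / 2) := by
  have hp : ∀ x, (φ x * conj (φ x) * algebraMap ℝ BC (Real.exp (-σ * x ^ 2))).plus =
      ((‖(φ x).plus‖ ^ 2 * Real.exp (-σ * x ^ 2) : ℝ) : ℂ) := fun x => by
    rw [plus_mul, plus_mul, plus_conj, Complex.mul_conj', plus_algebraMap]
    push_cast
    rfl
  have hm : ∀ x, (φ x * conj (φ x) * algebraMap ℝ BC (Real.exp (-σ * x ^ 2))).minus =
      ((‖(φ x).minus‖ ^ 2 * Real.exp (-σ * x ^ 2) : ℝ) : ℂ) := fun x => by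
    rw [minus_mul, minus_mul, minus_conj, Complex.mul_conj', minus_algebraMap]
    push_cast
    rfl
  have hi : IntegrableOn
      (fun x => φ x * conj (φ x) * algebraMap ℝ BC (Real.exp (-σ * x ^ 2))) Set.univ := by
    simp only [integrableOn_iff, hp, hm, integrableOn_univ]
    exact ⟨(integrable_weighted_sq_norm hσ hφ.1).ofReal,
      (integrable_weighted_sq_norm hσ hφ.2).ofReal⟩
  have e1 : (inner σ φ φ).plus.re =
      (eLpNorm (fun x => (φ x).plus) 2 (gaussMeasure σ)).toReal ^ 2 := by
    rw [inner, plus_mul, plus_integral hi, ← weighted_integral_sq_norm hφ.1]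
    simp only [hp, plus_algebraMap, setIntegral_univ]
    rw [integral_complex_ofReal, Complex.re_ofReal_mul, Complex.ofReal_re]
  have e2 : (inner σ φ φ).minus.re =
      (eLpNorm (fun x => (φ x).minus) 2 (gaussMeasure σ)).toReal ^ 2 := by
    rw [inner, minus_mul, minus_integral hi, ← weighted_integral_sq_norm hφ.2]
    simp only [hm, minus_algebraMap, setIntegral_univ]
    rw [integral_complex_ofReal, Complex.re_ofReal_mul, Complex.ofReal_re]
  rw [norm, e1, e2]

/-- Convergence in `L^{2,σ}_BC(ℝ)` is convergence of both idempotent components. -/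
theorem tendsto_norm_zero_iff {σ : ℝ} (hσ : 0 < σ) {F : ℝ → ℝ → BC} (hF : ∀ R, MemL2 σ (F R)) :
    Tendsto (fun R => norm σ (F R)) atTop (𝓝 0) ↔
      Tendsto (fun R => eLpNorm (fun x => (F R x).plus) 2 (gaussMeasure σ)) atTop (𝓝 0) ∧
      Tendsto (fun R => eLpNorm (fun x => (F R x).minus) 2 (gaussMeasure σ)) atTop (𝓝 0) := by
  rw [← ENNReal.tendsto_toReal_iff (fun R => (hF R).1.2.ne) ENNReal.zero_ne_top,
    ← ENNReal.tendsto_toReal_iff (fun R => (hF R).2.2.ne) ENNReal.zero_ne_top]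
  simp only [fun R => norm_eq hσ (hF R), ENNReal.toReal_zero]
  constructor
  · intro h
    -- Since the squared norm is half the sum of the squares, each component is at most √2 times the
    -- norm.
    have h2 := h.const_mul (Real.sqrt 2)
    rw [mul_zero] at h2
    constructor
    · refine squeeze_zero (fun R => ENNReal.toReal_nonneg) (fun R => ?_) h2
      rw [← Real.sqrt_mul (by norm_num)]
      have := sq_nonneg (eLpNorm (fun x => (F R x).minus) 2 (gaussMeasure σ)).toReal
      exact Real.le_sqrt_of_sq_le (by linarith)
    · refine squeeze_zero (fun R => ENNReal.toReal_nonneg) (fun R => ?_) h2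
      rw [← Real.sqrt_mul (by norm_num)]
      have := sq_nonneg (eLpNorm (fun x => (F R x).plus) 2 (gaussMeasure σ)).toReal
      exact Real.le_sqrt_of_sq_le (by linarith)
  · rintro ⟨ha, hb⟩
    have := (((ha.pow 2).add (hb.pow 2)).div_const 2).sqrt
    simpa using this

theorem MemL2.sub {σ : ℝ} {φ ψ : ℝ → BC} (hφ : MemL2 σ φ) (hψ : MemL2 σ ψ) :
    MemL2 σ fun x => φ x - ψ x := by
  simp only [MemL2, plus_sub, minus_sub]
  exact ⟨hφ.1.sub hψ.1, hφ.2.sub hψ.2⟩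

theorem ae_eq_of_tendsto_eLpNorm {μ : Measure ℝ} {T : ℝ → ℝ → ℂ} {g g' : ℝ → ℂ}
    (hT : ∀ R, AEStronglyMeasurable (T R) μ) (hg : AEStronglyMeasurable g μ)
    (hg' : AEStronglyMeasurable g' μ)
    (h : Tendsto (fun R => eLpNorm (fun y => T R y - g y) 2 μ) atTop (𝓝 0))
    (h' : Tendsto (fun R => eLpNorm (fun y => T R y - g' y) 2 μ) atTop (𝓝 0)) : g =ᵐ[μ] g' := by
  have h0 : eLpNorm (g - g') 2 μ ≤ 0 := by
    have hs := h'.add h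
    rw [add_zero] at hs
    refine ge_of_tendsto' hs fun R => ?_
    have : g - g' = (fun y => T R y - g' y) - fun y => T R y - g y := by
      ext y; simp
    rw [this]
    exact eLpNorm_sub_le ((hT R).sub hg') ((hT R).sub hg) (by norm_num)
  have h1 := (eLpNorm_eq_zero_iff (hg.sub hg') (by norm_num)).1 (le_antisymm h0 bot_le)
  filter_upwards [h1] with y hy
  exact sub_eq_zero.1 hy

/-- Plancherel theorem: the transform is the limit in the mean of the truncated integrals, and is
isometric. -/
theorem isFrftLimit_frft {σ : ℝ} (hσ : 0 < σ) {θ : BC} (hplus : ‖θ.plus‖ = 1)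
    (hminus : ‖θ.minus‖ = 1) (hθ : IsUnit (1 - θ ^ 2)) {ψ : ℝ → BC} (hψ : MemL2 σ ψ) :
    IsFrftLimit σ θ ψ (frft σ θ ψ) ∧ norm σ (frft σ θ ψ) = norm σ ψ := by
  have hu := isUnit_iff.1 hθ
  simp only [plus_sub, plus_one, plus_pow, minus_sub, minus_one, minus_pow] at hu
  obtain ⟨gp, hgp, hgpn, hgps⟩ := exists_scalarFrft_limit hσ hplus hu.1 hψ.1
  obtain ⟨gm, hgm, hgmn, hgms⟩ := exists_scalarFrft_limit hσ hminus hu.2 hψ.2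
  have hIp := integrableOn_mul_kernel_Icc hσ hplus hu.1 hψ.1
  have hIm := integrableOn_mul_kernel_Icc hσ hminus hu.2 hψ.2
  have hI : ∀ R y : ℝ, IntegrableOn (frftIntegrand σ θ ψ y) (Set.Icc (-R) R) := fun R y =>
    (integrableOn_frftIntegrand_iff hθ).2 ⟨hIp y _ _, hIm y _ _⟩
  have hTp := fun R : ℝ => hgps (Set.Icc (-R) R) measurableSet_Icc fun y => hIp y _ _
  have hTm := fun R : ℝ => hgms (Set.Icc (-R) R) measurableSet_Icc fun y => hIm y _ _
  have hT : ∀ R : ℝ, MemL2 σ (frftOn σ θ (Set.Icc (-R) R) ψ) := fun R => by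
    simp only [MemL2, plus_frftOn hθ (hI R _), minus_frftOn hθ (hI R _)]
    exact ⟨(hTp R).1, (hTm R).1⟩
  have htp : Tendsto (fun R : ℝ => eLpNorm (fun y => scalarFrftOn σ θ.plus (Set.Icc (-R) R)
      (fun x => (ψ x).plus) y - gp y) 2 (gaussMeasure σ)) atTop (𝓝 0) := by
    simp only [(hTp _).2]
    exact tendsto_eLpNorm_indicator_compl_Icc hψ.1
  have htm : Tendsto (fun R : ℝ => eLpNorm (fun y => scalarFrftOn σ θ.minus (Set.Icc (-R) R)
      (fun x => (ψ x).minus) y - gm y) 2 (gaussMeasure σ)) atTop (𝓝 0) := by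
    simp only [(hTm _).2]
    exact tendsto_eLpNorm_indicator_compl_Icc hψ.2
  have of_ae : ∀ g : ℝ → BC, gp =ᵐ[gaussMeasure σ] (fun y => (g y).plus) →
      gm =ᵐ[gaussMeasure σ] (fun y => (g y).minus) → IsFrftLimit σ θ ψ g := by
    intro g hp hm
    have hg : MemL2 σ g := ⟨hgp.ae_eq hp, hgm.ae_eq hm⟩
    refine ⟨hg, hI, hT, (tendsto_norm_zero_iff hσ fun R => (hT R).sub hg).2 ⟨?_, ?_⟩⟩
    · refine htp.congr fun R => eLpNorm_congr_ae ?_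
      filter_upwards [hp] with y hy
      rw [plus_sub, plus_frftOn hθ (hI R y), hy]
    · refine htm.congr fun R => eLpNorm_congr_ae ?_
      filter_upwards [hm] with y hy
      rw [minus_sub, minus_frftOn hθ (hI R y), hy]
  -- `frft` may pick its value by choice, so the isometry is proved for every limit: any limit
  -- agrees a.e. with (`gp`, `gm`).
  have norm_of_lim : ∀ g : ℝ → BC, IsFrftLimit σ θ ψ g → norm σ g = norm σ ψ := by
    rintro g ⟨hg, -, -, ht⟩
    obtain ⟨tp, tm⟩ := (tendsto_norm_zero_iff hσ fun R => (hT R).sub hg).1 ht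
    simp only [plus_sub, minus_sub, plus_frftOn hθ (hI _ _), minus_frftOn hθ (hI _ _)] at tp tm
    have hp := ae_eq_of_tendsto_eLpNorm (fun R => (hTp R).1.1) hgp.1 hg.1.1 htp tp
    have hm := ae_eq_of_tendsto_eLpNorm (fun R => (hTm R).1.1) hgm.1 hg.2.1 htm tm
    rw [norm_eq hσ hg, norm_eq hσ hψ, ← eLpNorm_congr_ae hp, ← eLpNorm_congr_ae hm, hgpn, hgmn]
  suffices h : IsFrftLimit σ θ ψ (frft σ θ ψ) from ⟨h, norm_of_lim _ h⟩
  unfold frft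
  split_ifs with h1 h2
  -- If the full integral converges absolutely, take s = ℝ: its complement is empty, so the error is
  -- zero.
  · have h1' := fun y => (integrableOn_frftIntegrand_iff hθ).1 (h1 y)
    have ae_of_univ : ∀ (T g : ℝ → ℂ) (f : ℝ → ℂ), MemLp T 2 (gaussMeasure σ) →
        MemLp g 2 (gaussMeasure σ) →
        eLpNorm (fun y => T y - g y) 2 (gaussMeasure σ) =
          eLpNorm (Set.univᶜ.indicator f) 2 (gaussMeasure σ) → g =ᵐ[gaussMeasure σ] T := by
      intro T g f hT hg he
      rw [Set.compl_univ, Set.indicator_empty, eLpNorm_zero'] at he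
      filter_upwards [(eLpNorm_eq_zero_iff (hT.1.sub hg.1) (by norm_num)).1 he] with y hy
      exact (sub_eq_zero.1 hy).symm
    have hp := hgps Set.univ MeasurableSet.univ fun y => (h1' y).1
    have hm := hgms Set.univ MeasurableSet.univ fun y => (h1' y).2
    refine of_ae _ ?_ ?_
    · simp only [plus_frftOn hθ (h1 _)]
      exact ae_of_univ _ _ _ hp.1 hgp hp.2
    · simp only [minus_frftOn hθ (h1 _)]
      exact ae_of_univ _ _ _ hm.1 hgm hm.2
  · exact h2.choose_spec
  -- The default value 0 never occurs, since `gp` e₊ + `gm` e₋ is a limit.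
  · exact absurd ⟨_, of_ae (fun y => ofIdem (gp y) (gm y)) (by simp) (by simp)⟩ h2
-- Hermite polynomials
open Polynomial

/-- The polynomials `H_n^σ`, defined by `H_{n+1}^σ = 2σ x H_n^σ - (H_n^σ)'`. -/
noncomputable def hermitePoly (σ : ℝ) : ℕ → ℝ[X]
  | 0 => 1
  | n + 1 => C (2 * σ) * X * hermitePoly σ n - derivative (hermitePoly σ n)

theorem iteratedDeriv_gaussian (σ : ℝ) (n : ℕ) :
    iteratedDeriv n (fun t : ℝ => Real.exp (-σ * t ^ 2)) =
      fun x => (-1) ^ n * (hermitePoly σ n).eval x * Real.exp (-σ * x ^ 2) := by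
  induction n with
  | zero => ext x; simp [hermitePoly]
  | succ n ih =>
    rw [iteratedDeriv_succ, ih]
    ext x
    have h1 : HasDerivAt (fun x : ℝ => Real.exp (-σ * x ^ 2))
        (Real.exp (-σ * x ^ 2) * (-σ * (2 * x))) x := by
      have := ((hasDerivAt_pow 2 x).const_mul (-σ)).exp
      simpa using this
    have h2 := (((hermitePoly σ n).hasDerivAt x).const_mul ((-1 : ℝ) ^ n)).mul h1
    refine h2.deriv.trans ?_
    simp only [hermitePoly, eval_sub, eval_mul, eval_C, eval_X]
    ring

theorem hermite_eq_eval (σ : ℝ) (n : ℕ) (x : ℝ) : hermite σ n x = (hermitePoly σ n).eval x := by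
  rw [hermite, iteratedDeriv_gaussian]
  have h : Real.exp (σ * x ^ 2) * Real.exp (-σ * x ^ 2) = 1 := by
    rw [← Real.exp_add]; simp
  have h' : ((-1 : ℝ) ^ n) * (-1) ^ n = 1 := by rw [← mul_pow]; simp
  linear_combination (hermitePoly σ n).eval x * (-1) ^ n * (-1) ^ n * h +
    (hermitePoly σ n).eval x * h'

/-- Differentiate the recursion: by induction the terms other than 2σH_{n+1} combine to
2σ(n+1)(2σxH_n - H_n'), and the bracket is H_{n+1} again. -/
theorem derivative_hermitePoly (σ : ℝ) (n : ℕ) :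
    derivative (hermitePoly σ (n + 1)) = C (2 * σ * (n + 1)) * hermitePoly σ n := by
  induction n with
  | zero => simp [hermitePoly]
  | succ n ih =>
    rw [hermitePoly, derivative_sub, derivative_mul, derivative_C_mul, derivative_X, ih,
      derivative_C_mul]
    rw [hermitePoly]
    simp only [map_mul, map_add, map_one, Nat.cast_add, Nat.cast_one]
    ring

theorem integrable_pow_mul_exp_neg_mul_sq {b : ℝ} (hb : 0 < b) (n : ℕ) :
    Integrable fun x : ℝ => x ^ n * Real.exp (-b * x ^ 2) := by
  simpa using integrable_rpow_mul_exp_neg_mul_sq hb (s := n) (by linarith [n.cast_nonneg (α := ℝ)])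

theorem integrable_eval_mul_exp_neg_mul_sq {b : ℝ} (hb : 0 < b) (p : ℝ[X]) :
    Integrable fun x : ℝ => p.eval x * Real.exp (-b * x ^ 2) := by
  simp only [eval_eq_sum_range, Finset.sum_mul, mul_assoc]
  exact integrable_finsetSum _ fun i _ =>
    (integrable_pow_mul_exp_neg_mul_sq hb i).const_mul _

theorem memLp_eval {σ : ℝ} (hσ : 0 < σ) (p : ℝ[X]) :
    MemLp (fun x : ℝ => ((p.eval x : ℝ) : ℂ)) 2 (gaussMeasure σ) := by
  have hc : Continuous fun x : ℝ => ((p.eval x : ℝ) : ℂ) := by fun_prop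
  rw [memLp_two_iff_integrable_sq_norm hc.aestronglyMeasurable, gaussMeasure,
    integrable_withDensity_iff_integrable_smul' (by fun_prop)
      (ae_of_all _ fun x => ENNReal.ofReal_lt_top)]
  refine ((integrable_eval_mul_exp_neg_mul_sq hσ (p ^ 2)).const_mul (c₀ σ)).congr
    (ae_of_all _ fun x => ?_)
  have := c₀_nonneg σ
  simp only [smul_eq_mul]
  rw [ENNReal.toReal_ofReal (by positivity), Complex.norm_real, Real.norm_eq_abs, sq_abs,
    eval_pow]
  ring

/-! ### Integrals of Hermite polynomials against the kernel -/

section Unimodular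

variable {α : ℂ}

/-- The input weight has modulus √c₀ e^{-σx²/2}, which beats every polynomial. -/
theorem integrable_eval_mul_kernel {σ : ℝ} (hσ : 0 < σ) (h1 : ‖α‖ = 1) (h2 : 1 - α ^ 2 ≠ 0)
    (p : ℝ[X]) (y : ℝ) : Integrable fun x : ℝ => ((p.eval x : ℝ) : ℂ) * kernel σ α y x := by
  rw [← integrableOn_univ, integrableOn_mul_kernel_iff hσ h1 h2, integrableOn_univ]
  have hc : Continuous fun x : ℝ => inWeight σ α x * ((p.eval x : ℝ) : ℂ) :=
    (continuous_inWeight σ α).mul (by fun_prop)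
  have hi := ((integrable_eval_mul_exp_neg_mul_sq (half_pos hσ) p).const_mul
    (Real.sqrt (c₀ σ))).norm
  refine hi.mono' hc.aestronglyMeasurable (ae_of_all _ fun x => le_of_eq ?_)
  have hw : ‖inWeight σ α x‖ = Real.sqrt (c₀ σ) * Real.exp (-(σ / 2) * x ^ 2) := by
    refine (sq_eq_sq₀ (norm_nonneg _) (by positivity)).1 ?_
    rw [norm_sq_inWeight h1 h2, mul_pow, Real.sq_sqrt (c₀_nonneg σ), ← Real.exp_nat_mul]
    congr 2
    push_cast
    ring
  rw [norm_mul, hw, Complex.norm_real, norm_mul, norm_mul, Real.norm_of_nonneg (Real.sqrt_nonneg _),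
    Real.norm_of_nonneg (Real.exp_nonneg _)]
  ring

theorem hasDerivAt_kernel (σ : ℝ) (α : ℂ) (y x : ℝ) :
    HasDerivAt (kernel σ α y)
      (-(2 * σ * (1 - α ^ 2)⁻¹ * (x - α * y)) * kernel σ α y x) x := by
  have h : HasDerivAt (fun x : ℝ => (x : ℂ) - α * y) 1 x := by
    simpa using (hasDerivAt_id x).ofReal_comp.sub_const (α * y)
  have h' := (((h.pow 2).const_mul ((σ : ℂ) * (1 - α ^ 2)⁻¹)).neg).cexp
  refine h'.congr_deriv ?_
  simp only [kernel, Pi.neg_apply, Pi.pow_apply]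
  push_cast
  ring

/-- Integration by parts against the kernel. -/
theorem integral_X_mul_kernel {σ : ℝ} (hσ : 0 < σ) (h1 : ‖α‖ = 1) (h2 : 1 - α ^ 2 ≠ 0)
    (p : ℝ[X]) (y : ℝ) :
    2 * σ * ∫ x : ℝ, (((X * p).eval x : ℝ) : ℂ) * kernel σ α y x =
      2 * σ * α * y * (∫ x : ℝ, ((p.eval x : ℝ) : ℂ) * kernel σ α y x) +
      (1 - α ^ 2) * ∫ x : ℝ, (((derivative p).eval x : ℝ) : ℂ) * kernel σ α y x := by
  have hint := fun q : ℝ[X] => integrable_eval_mul_kernel hσ h1 h2 q y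
  have hd : ∀ x : ℝ, HasDerivAt (fun x : ℝ => ((p.eval x : ℝ) : ℂ) * kernel σ α y x)
      ((((derivative p).eval x : ℝ) : ℂ) * kernel σ α y x +
        (-(2 * σ * (1 - α ^ 2)⁻¹) * ((((X * p).eval x : ℝ) : ℂ) * kernel σ α y x) +
        (2 * σ * (1 - α ^ 2)⁻¹ * α * y) * (((p.eval x : ℝ) : ℂ) * kernel σ α y x))) x := by
    intro x
    refine ((p.hasDerivAt x).ofReal_comp.mul (hasDerivAt_kernel σ α y x)).congr_deriv ?_
    rw [eval_mul, eval_X]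
    push_cast
    ring
  have hXp : Integrable fun x : ℝ =>
      -(2 * σ * (1 - α ^ 2)⁻¹) * ((((X * p).eval x : ℝ) : ℂ) * kernel σ α y x) +
        (2 * σ * (1 - α ^ 2)⁻¹ * α * y) * (((p.eval x : ℝ) : ℂ) * kernel σ α y x) :=
    ((hint _).const_mul _).add ((hint _).const_mul _)
  -- The derivative of p · kernel has integral zero, because both it and p · kernel are integrable.
  have h0 := integral_eq_zero_of_hasDerivAt_of_integrable hd ((hint _).add hXp) (hint p)
  rw [integral_add (hint _) hXp,
    integral_add ((hint _).const_mul _) ((hint _).const_mul _), integral_const_mul,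
    integral_const_mul] at h0
  have hw : (1 - α ^ 2) * (1 - α ^ 2)⁻¹ = 1 := mul_inv_cancel₀ h2
  generalize (∫ x : ℝ, (((X * p).eval x : ℝ) : ℂ) * kernel σ α y x) = A at *
  generalize (∫ x : ℝ, ((p.eval x : ℝ) : ℂ) * kernel σ α y x) = B at *
  generalize (∫ x : ℝ, (((derivative p).eval x : ℝ) : ℂ) * kernel σ α y x) = D at *
  linear_combination (-(1 - α ^ 2)) * h0 + (-2 * σ * A + 2 * σ * α * y * B) * hw

/-- Integration by parts replaces 2σxH_n; the coefficient of the H_n' integral becomes (1 - α²) - 1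
= -α². -/
theorem integral_hermitePoly_succ_mul_kernel {σ : ℝ} (hσ : 0 < σ) (h1 : ‖α‖ = 1)
    (h2 : 1 - α ^ 2 ≠ 0) (n : ℕ) (y : ℝ) :
    ∫ x : ℝ, (((hermitePoly σ (n + 1)).eval x : ℝ) : ℂ) * kernel σ α y x =
      2 * σ * α * y * (∫ x : ℝ, (((hermitePoly σ n).eval x : ℝ) : ℂ) * kernel σ α y x) -
      α ^ 2 * ∫ x : ℝ, (((derivative (hermitePoly σ n)).eval x : ℝ) : ℂ) * kernel σ α y x := by
  have hint := fun q : ℝ[X] => integrable_eval_mul_kernel hσ h1 h2 q y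
  have hp := integral_X_mul_kernel hσ h1 h2 (hermitePoly σ n) y
  have hs : ∫ x : ℝ, (((hermitePoly σ (n + 1)).eval x : ℝ) : ℂ) * kernel σ α y x =
      2 * σ * (∫ x : ℝ, (((X * hermitePoly σ n).eval x : ℝ) : ℂ) * kernel σ α y x) -
      ∫ x : ℝ, (((derivative (hermitePoly σ n)).eval x : ℝ) : ℂ) * kernel σ α y x := by
    rw [← integral_const_mul, ← integral_sub ((hint _).const_mul _) (hint _)]
    congr 1
    ext x
    simp only [hermitePoly, eval_sub, eval_mul, eval_C, eval_X]
    push_cast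
    ring
  rw [hs, hp]
  ring

theorem integral_kernel {σ : ℝ} (hσ : 0 < σ) (h1 : ‖α‖ = 1) (h2 : 1 - α ^ 2 ≠ 0) (y : ℝ) :
    c₀ σ * (Complex.sqrt (1 - α ^ 2))⁻¹ * ∫ x : ℝ, kernel σ α y x = 1 := by
  have hre : (-((σ : ℂ) * (1 - α ^ 2)⁻¹)).re < 0 := by
    rw [inv_one_sub_sq_of_unimodular h1 h2]
    generalize α.re / (2 * α.im) = t
    simp [hσ]
  have hσ' : (σ : ℂ) ≠ 0 := by exact_mod_cast hσ.ne'
  have hk : ∀ x : ℝ, kernel σ α y x = Complex.exp (-(σ * (1 - α ^ 2)⁻¹) * x ^ 2 +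
      (2 * (σ * (1 - α ^ 2)⁻¹) * α * y) * x + -(σ * (1 - α ^ 2)⁻¹) * (α * y) ^ 2) := fun x => by
    rw [kernel]; congr 1; ring
  simp only [hk]
  rw [integral_cexp_quadratic hre]
  -- The exponent is a perfect square, so completing the square leaves no dependence on y.
  have he : -(σ * (1 - α ^ 2)⁻¹) * (α * y) ^ 2 - (2 * (σ * (1 - α ^ 2)⁻¹) * α * y) ^ 2 /
      (4 * -(σ * (1 - α ^ 2)⁻¹)) = 0 := by
    field_simp
    ring
  have hq : (Real.pi : ℂ) / - -(σ * (1 - α ^ 2)⁻¹) = ((Real.pi / σ : ℝ) : ℂ) * (1 - α ^ 2) := by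
    push_cast
    field_simp
  have hr : Complex.sqrt (1 - α ^ 2) ≠ 0 := by
    simp [Complex.sqrt, Complex.cpow_eq_zero_iff, h2]
  have hpos : 0 < Real.pi / σ := by positivity
  -- A positive real factor leaves the argument unchanged, so the principal root splits without a
  -- branch correction.
  have hm : (((Real.pi / σ : ℝ) : ℂ) * (1 - α ^ 2)) ^ (1 / 2 : ℂ) =
      (Real.sqrt (Real.pi / σ) : ℂ) * Complex.sqrt (1 - α ^ 2) := by
    have hr0 : ((Real.pi / σ : ℝ) : ℂ) ≠ 0 := by exact_mod_cast hpos.ne'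
    rw [Complex.sqrt, Real.sqrt_eq_rpow, Complex.ofReal_cpow hpos.le,
      Complex.cpow_def_of_ne_zero (mul_ne_zero hr0 h2), Complex.cpow_def_of_ne_zero hr0,
      Complex.cpow_def_of_ne_zero h2, Complex.log_ofReal_mul hpos h2, ← Complex.exp_add,
      Complex.ofReal_log hpos.le]
    congr 1
    push_cast
    ring
  rw [he, Complex.exp_zero, hq, hm]
  have hc : (c₀ σ : ℂ) * (Real.sqrt (Real.pi / σ) : ℂ) = 1 := by
    rw [c₀, ← Complex.ofReal_mul, ← Real.sqrt_mul (by positivity)]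
    have : σ / Real.pi * (Real.pi / σ) = 1 := by field_simp
    simp [this]
  field_simp
  linear_combination hc

/-- Both sides satisfy u_{n+2} = 2σαy u_{n+1} - 2σ(n+1)α² u_n. For the right side this is the
three-term Hermite recurrence multiplied by α^{n+2}. -/
theorem scalarFrftOn_hermitePoly {σ : ℝ} (hσ : 0 < σ) (h1 : ‖α‖ = 1) (h2 : 1 - α ^ 2 ≠ 0)
    (n : ℕ) (y : ℝ) :
    scalarFrftOn σ α Set.univ (fun x => (((hermitePoly σ n).eval x : ℝ) : ℂ)) y =
      α ^ n * (((hermitePoly σ n).eval y : ℝ) : ℂ) := by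
  have h0 : scalarFrftOn σ α Set.univ (fun x => (((hermitePoly σ 0).eval x : ℝ) : ℂ)) y =
      α ^ 0 * (((hermitePoly σ 0).eval y : ℝ) : ℂ) := by
    simpa [scalarFrftOn, hermitePoly] using integral_kernel hσ h1 h2 y
  induction n using Nat.twoStepInduction with
  | zero => exact h0
  | one =>
    have hs := integral_hermitePoly_succ_mul_kernel hσ h1 h2 0 y
    simp only [scalarFrftOn, setIntegral_univ] at h0 ⊢
    rw [hs]
    simp only [hermitePoly, eval_one, derivative_one, eval_zero] at h0 ⊢
    simp at h0 ⊢
    linear_combination 2 * σ * α * y * h0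
  | more n ih0 ih1 =>
    have hs := integral_hermitePoly_succ_mul_kernel hσ h1 h2 (n + 1) y
    have hd : ∫ x : ℝ, (((derivative (hermitePoly σ (n + 1))).eval x : ℝ) : ℂ) * kernel σ α y x =
        2 * σ * (n + 1) * ∫ x : ℝ, (((hermitePoly σ n).eval x : ℝ) : ℂ) * kernel σ α y x := by
      rw [← integral_const_mul]
      congr 1
      ext x
      rw [derivative_hermitePoly, eval_mul, eval_C]
      push_cast
      ring
    have hy : (hermitePoly σ (n + 2)).eval y = 2 * σ * y * (hermitePoly σ (n + 1)).eval y -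
        2 * σ * (n + 1) * (hermitePoly σ n).eval y := by
      rw [hermitePoly, eval_sub, derivative_hermitePoly]
      simp only [eval_mul, eval_C, eval_X]
    simp only [scalarFrftOn, setIntegral_univ] at ih0 ih1 ⊢
    rw [hs, hd, hy]
    push_cast
    linear_combination 2 * σ * α * y * ih1 - α ^ 2 * (2 * σ * (n + 1)) * ih0

theorem scalarFrftOn_const_mul (σ : ℝ) (α : ℂ) (s : Set ℝ) (c : ℂ) (f : ℝ → ℂ) (y : ℝ) :
    scalarFrftOn σ α s (fun x => c * f x) y = c * scalarFrftOn σ α s f y := by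
  simp only [scalarFrftOn, mul_assoc c, integral_const_mul]
  ring

end Unimodular

/-- The normalizing constant is left unspecified, since the eigenvalue relation is homogeneous. -/
theorem hermiteFun_eq (σ : ℝ) (n : ℕ) : ∃ c : ℝ, ∀ x, hermiteFun σ n x =
    algebraMap ℝ BC (c * (hermitePoly σ n).eval x) :=
  ⟨_, fun x => by rw [hermiteFun, hermite_eq_eval]⟩

end BC

/-- Plancherel theorem for the bicomplex fractional Fourier transform, and its action on the
normalized Hermite functions. The parameter is `θ = α e₊ + β e₋` with `|α| = |β| = 1` and
`1 - θ²` invertible. -/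
theorem mainTheorem6 (σ : ℝ) (hσ : 0 < σ) (θ : BC)
    (hplus : ‖θ.plus‖ = 1) (hminus : ‖θ.minus‖ = 1) (hθ : IsUnit (1 - θ ^ 2)) :
    (∀ ψ : ℝ → BC, BC.MemL2 σ ψ →
      BC.IsFrftLimit σ θ ψ (BC.frft σ θ ψ) ∧
      BC.norm σ (BC.frft σ θ ψ) = BC.norm σ ψ) ∧
    (∀ n : ℕ,
      BC.MemL2 σ (BC.hermiteFun σ n) ∧
      (∀ y : ℝ, BC.IntegrableOn (BC.frftIntegrand σ θ (BC.hermiteFun σ n) y) Set.univ) ∧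
      ∀ y : ℝ, BC.frft σ θ (BC.hermiteFun σ n) y = θ ^ n * BC.hermiteFun σ n y) := by
  refine ⟨fun ψ hψ => BC.isFrftLimit_frft hσ hplus hminus hθ hψ, fun n => ?_⟩
  have hu := BC.isUnit_iff.1 hθ
  simp only [BC.plus_sub, BC.plus_one, BC.plus_pow, BC.minus_sub, BC.minus_one,
    BC.minus_pow] at hu
  obtain ⟨c, hc⟩ := BC.hermiteFun_eq σ n
  have hp : ∀ x, (BC.hermiteFun σ n x).plus = c * (((BC.hermitePoly σ n).eval x : ℝ) : ℂ) :=
    fun x => by rw [hc, BC.plus_algebraMap, Complex.ofReal_mul]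
  have hm : ∀ x, (BC.hermiteFun σ n x).minus = c * (((BC.hermitePoly σ n).eval x : ℝ) : ℂ) :=
    fun x => by rw [hc, BC.minus_algebraMap, Complex.ofReal_mul]
  have hI : ∀ y : ℝ, BC.IntegrableOn (BC.frftIntegrand σ θ (BC.hermiteFun σ n) y) Set.univ := by
    intro y
    rw [BC.integrableOn_frftIntegrand_iff hθ]
    simp only [hp, hm, mul_assoc, integrableOn_univ]
    exact ⟨(BC.integrable_eval_mul_kernel hσ hplus hu.1 _ y).const_mul _,
      (BC.integrable_eval_mul_kernel hσ hminus hu.2 _ y).const_mul _⟩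
  refine ⟨?_, hI, fun y => ?_⟩
  · simp only [BC.MemL2, hp, hm]
    exact ⟨(BC.memLp_eval hσ _).const_mul _, (BC.memLp_eval hσ _).const_mul _⟩
  -- Absolute convergence selects the integral itself, so the identity holds at every y and not only
  -- a.e.
  · rw [BC.frft, if_pos hI]
    refine BC.ext_idem ?_ ?_
    · rw [BC.plus_frftOn hθ (hI y), BC.plus_mul, BC.plus_pow]
      simp only [hp]
      rw [BC.scalarFrftOn_const_mul, BC.scalarFrftOn_hermitePoly hσ hplus hu.1]
      ring
    · rw [BC.minus_frftOn hθ (hI y), BC.minus_mul, BC.minus_pow]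
      simp only [hm]
      rw [BC.scalarFrftOn_const_mul, BC.scalarFrftOn_hermitePoly hσ hminus hu.2]
      ring
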